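/- All Banach algebras are complex, associative, not necessarily unital, with submultiplicative norm. Let $\Omega$ be a locally compact Hausdorff space. A continuous field of Banach algebras $\mathcal{U}=\{\Omega,(A_t)_{t\in\Omega},\Theta\}$ over $\Omega$ consists of Banach algebras $A_t$ ($t\in\Omega$) and a subalgebra $\Theta$ of $\prod_{t\in\Omega}A_t$ such that (1) for every $t$ the set $\{x(t):x\in\Theta\}$ is dense in $A_t$; (2) $t\mapsto\|x(t)\|$ is continuous on $\Omega$ for every $x\in\Theta$; (3) if $x\in\prod_{t}A_t$ and for every $t\in\Omega$ and $\varepsilon>0$ there is $x'\in\Theta$ with $\|x(s)-x'(s)\|\le\varepsilon$ for all $s$ in some neighbourhood of $t$, then $x\in\Theta$. For $Y\subseteq\Omega$, a family $x\in\prod_{t\in Y}A_t$ is continuous on $Y$ if for every $t\in Y$ and $\varepsilon>0$ there is $x'\in\Theta$ with $\|x(s)-x'(s)\|\le\varepsilon$ for all $s\in Y$ in some neighbourhood of $t$. The field is locally trivial if every point of $\Omega$ has a neighbourhood $V$ for which there are a Banach algebra $B$ and isometric algebra isomorphisms $\varphi_t:A_t\to B$ ($t\in V$) such that $x\in\prod_{t\in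 V}A_t$ is continuous on $V$ if and only if $t\mapsto\varphi_t(x(t))$ is a continuous map $V\to B$. The Banach algebra $\mathfrak{A}$ defined by $\mathcal{U}$ consists of all $x\in\Theta$ such that $\|x(t)\|$ vanishes at infinity on $\Omega$, with pointwise operations and the norm $\|x\|=\sup_{t\in\Omega}\|x(t)\|$. For a Banach algebra $A$, let $A_+=A\oplus\mathbb{C}e$ be the algebra obtained by adjoining an identity to $A$, with $\|a+\lambda e\|=\|a\|+|\lambda|$. A Banach $A$-bimodule is a Banach space with bounded bilinear, associative and commuting left and right actions of $A$. A Banach $A$-bimodule $P$ is projective if every morphism of Banach $A$-bimodules $\varphi:Y\to P$ that has a right inverse among bounded linear maps has a right inverse among morphisms of Banach $A$-bimodules. The algebra $A$ is contractible if the Banach $A$-bimodule $A_+$ is projective. For a Banach $A$-bimodule $X$, $\mathcal{H}^n(A,X)$ denotes the $n$-th continuous Hochschild cohomology group, that is, the $n$-th cohomology of the complex of bounded $n$-linear maps $f:A^n\to X$ with $$(\delta^nf)(a_1,\dots,a_{n+1})=a_1\cdot f(a_2,\dots,a_{n+1})+\sum_{i=1}^n(-1)^if(a_1,\dots,a_ia_{i+1},\dots,a_{n+1})+(-1)^{n+1}f(a_1,\dots,a_n)\cdot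 a_{n+1}.$$ Theorem. Let $\Omega$ be a locally compact Hausdorff space, let $\mathcal{U}=\{\Omega,(A_x)_{x\in\Omega},\Theta\}$ be a locally trivial continuous field of non-zero Banach algebras, and let $\mathfrak{A}$ be the Banach algebra defined by $\mathcal{U}$. Then the following conditions are equivalent: (i) $\mathfrak{A}$ is contractible; (ii) $\Omega$ is finite and discrete, and all the Banach algebras $A_x$, $x\in\Omega$, are contractible; (iii) $\mathcal{H}^n(\mathfrak{A},X)=\{0\}$ for every Banach $\mathfrak{A}$-bimodule $X$ and all $n\ge1$. -/

import Mathlib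

open Filter Topology
open scoped ENNReal

universe u v w

namespace ContFieldAlg

/-! ## Banach bimodules, projectivity and contractibility -/

/-- The structure of a Banach `A`-bimodule on the Banach space `X`: jointly bounded bilinear left
and right actions `a · x = left a x` and `x · a = right a x` that are associative and commute with
each other. No unit is assumed to exist or to act as the identity. -/
structure BanachBimodule (A : Type u) [NonUnitalNormedRing A] [NormedSpace ℂ A]
    (X : Type v) [NormedAddCommGroup X] [NormedSpace ℂ X] where
  /-- `left a x = a · x` -/
  left : A →L[ℂ] X →L[ℂ] X
  /-- `right a x = x · a` -/
  right : A →L[ℂ] X →L[ℂ] X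
  left_mul : ∀ (a b : A) (x : X), left (a * b) x = left a (left b x)
  right_mul : ∀ (a b : A) (x : X), right (a * b) x = right b (right a x)
  left_right : ∀ (a b : A) (x : X), left a (right b x) = right b (left a x)

section Projective

variable {A : Type u} [NonUnitalNormedRing A] [NormedSpace ℂ A]

/-- A bounded linear map is a morphism of Banach `A`-bimodules. -/
def BanachBimodule.IsMorphism {X : Type v} [NormedAddCommGroup X] [NormedSpace ℂ X]
    {Y : Type w} [NormedAddCommGroup Y] [NormedSpace ℂ Y]
    (M : BanachBimodule A X) (N : BanachBimodule A Y) (f : X →L[ℂ] Y) : Prop :=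
  (∀ (a : A) (x : X), f (M.left a x) = N.left a (f x)) ∧
    ∀ (a : A) (x : X), f (M.right a x) = N.right a (f x)

/-- Projectivity of a Banach bimodule `P` in the category of Banach `A`-bimodules: every morphism
`φ : Y → P` that has a right inverse among bounded linear maps (such a `φ` is onto, in particular
an epimorphism) has a right inverse among bimodule morphisms. -/
def BanachBimodule.IsProjective {P : Type u} [NormedAddCommGroup P] [NormedSpace ℂ P]
    (M : BanachBimodule A P) : Prop :=
  ∀ (Y : Type u) [NormedAddCommGroup Y] [NormedSpace ℂ Y] [CompleteSpace Y]
    (N : BanachBimodule A Y) (φ : Y →L[ℂ] P), N.IsMorphism M φ →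
    (∃ σ : P →L[ℂ] Y, φ.comp σ = ContinuousLinearMap.id ℂ P) →
    ∃ ψ : P →L[ℂ] Y, M.IsMorphism N ψ ∧ φ.comp ψ = ContinuousLinearMap.id ℂ P

end Projective

section Unitization

variable (A : Type u) [NonUnitalNormedRing A] [NormedSpace ℂ A]

/-- The algebra `A₊ = A ⊕ ℂ e` obtained by adjoining an identity to `A` (whether or not `A` has
one), with the norm `‖a + λ e‖ = ‖a‖ + |λ|`. -/
abbrev Aplus : Type u := WithLp 1 (Unitization ℂ A)

variable [IsScalarTower ℂ A A] [SMulCommClass ℂ A A]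

/-- The inclusion `A → A₊`, `a ↦ a + 0 e`, as a bounded linear map. -/
noncomputable def inclPlus : A →L[ℂ] Aplus A :=
  LinearMap.mkContinuous
    (((WithLp.linearEquiv 1 ℂ (Unitization ℂ A)).symm : Unitization ℂ A →ₗ[ℂ] Aplus A).comp
      (Unitization.inrHom ℂ ℂ A)) 1
    (fun a => by
      rw [one_mul]
      exact (WithLp.unitization_norm_inr (𝕜 := ℂ) a).le)

variable {A} in
theorem inclPlus_apply (a : A) : inclPlus A a = WithLp.toLp 1 (a : Unitization ℂ A) := rfl

variable {A} in
theorem inclPlus_mul (a b : A) : inclPlus A (a * b) = inclPlus A a * inclPlus A b := by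
  apply (WithLp.equiv 1 (Unitization ℂ A)).injective
  exact Unitization.inr_mul ℂ a b

/-- `A₊` as a Banach `A`-bimodule under multiplication in `A₊`. -/
noncomputable def plusBimodule : BanachBimodule A (Aplus A) where
  left := (ContinuousLinearMap.mul ℂ (Aplus A)).comp (inclPlus A)
  right := (ContinuousLinearMap.mul ℂ (Aplus A)).flip.comp (inclPlus A)
  left_mul a b x := by simp [inclPlus_mul, mul_assoc]
  right_mul a b x := by simp [inclPlus_mul, mul_assoc]
  left_right a b x := by simp [mul_assoc]

theorem plusBimodule_left (a : A) (x : Aplus A) :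
    (plusBimodule A).left a x = inclPlus A a * x := rfl

theorem plusBimodule_right (a : A) (x : Aplus A) :
    (plusBimodule A).right a x = x * inclPlus A a := rfl

/-- A Banach algebra `A` is contractible if `A₊` is projective in the category of Banach
`A`-bimodules. -/
def IsContractible : Prop := (plusBimodule A).IsProjective

end Unitization

/-! ## Continuous Hochschild cohomology -/

section Hochschild

variable {A : Type u} [NonUnitalNormedRing A] [NormedSpace ℂ A]

section Merge

variable [IsScalarTower ℂ A A] [SMulCommClass ℂ A A]

theorem contractNth_update {n : ℕ} (j : Fin n) (g : Fin (n + 1) → A) (i : Fin (n + 1)) :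
    ∃ (k : Fin n) (L : A →ₗ[ℂ] A), ∀ x : A,
      Fin.contractNth j.castSucc (· * ·) (Function.update g i x) =
        Function.update (Fin.contractNth j.castSucc (· * ·) g) k (L x) := by
  rcases lt_trichotomy (i : ℕ) (j : ℕ) with h | h | h
  · refine ⟨⟨i, by omega⟩, LinearMap.id, fun x => funext fun k => ?_⟩
    simp only [Fin.contractNth, Function.update_apply, Fin.ext_iff, Fin.val_castSucc, Fin.val_succ,
      LinearMap.id_apply]
    grind
  · refine ⟨j, (LinearMap.mulRight ℂ (g j.succ) : A →ₗ[ℂ] A), fun x => funext fun k => ?_⟩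
    simp only [Fin.contractNth, Function.update_apply, Fin.ext_iff, Fin.val_castSucc, Fin.val_succ,
      LinearMap.mulRight_apply]
    grind
  · by_cases h' : (i : ℕ) = j + 1
    · refine ⟨j, (LinearMap.mulLeft ℂ (g j.castSucc) : A →ₗ[ℂ] A), fun x => funext fun k => ?_⟩
      simp only [Fin.contractNth, Function.update_apply, Fin.ext_iff, Fin.val_castSucc,
        Fin.val_succ, LinearMap.mulLeft_apply]
      grind
    · refine ⟨⟨i - 1, by omega⟩, LinearMap.id, fun x => funext fun k => ?_⟩
      simp only [Fin.contractNth, Function.update_apply, Fin.ext_iff, Fin.val_castSucc,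
        Fin.val_succ, LinearMap.id_apply]
      grind

variable {X : Type v} [NormedAddCommGroup X] [NormedSpace ℂ X]

/-- For a bounded `n`-linear `f` and `j < n` (counted from `0`), the bounded `(n+1)`-linear map
`(a₀, …, aₙ) ↦ f (a₀, …, aⱼ aⱼ₊₁, …, aₙ)`. -/
noncomputable def mergeTerm {n : ℕ} (f : ContinuousMultilinearMap ℂ (fun _ : Fin n => A) X)
    (j : Fin n) : ContinuousMultilinearMap ℂ (fun _ : Fin (n + 1) => A) X where
  toMultilinearMap := MultilinearMap.mk' (fun a => f (Fin.contractNth j.castSucc (· * ·) a))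
    (fun g i x y => by
      obtain ⟨k, L, h⟩ := contractNth_update j g i
      simp only [h, map_add, ContinuousMultilinearMap.map_update_add])
    (fun g i c x => by
      obtain ⟨k, L, h⟩ := contractNth_update j g i
      simp only [h, map_smul, ContinuousMultilinearMap.map_update_smul])
  cont := by
    refine f.cont.comp (continuous_pi fun k => ?_)
    simp only [Fin.contractNth]
    split_ifs <;> fun_prop

end Merge

variable [IsScalarTower ℂ A A] [SMulCommClass ℂ A A]
variable {X : Type v} [NormedAddCommGroup X] [NormedSpace ℂ X]

/-- The value of the Hochschild coboundary operator on a cochain. -/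
noncomputable def coboundaryFun (M : BanachBimodule A X) (n : ℕ)
    (f : ContinuousMultilinearMap ℂ (fun _ : Fin n => A) X) :
    ContinuousMultilinearMap ℂ (fun _ : Fin (n + 1) => A) X :=
  ContinuousLinearMap.uncurryLeft (Ei := fun _ : Fin (n + 1) => A)
      (((ContinuousLinearMap.compContinuousMultilinearMapL ℂ (fun _ : Fin n => A) X X).flip
        f).comp M.left)
    + ∑ j : Fin n, (-1 : ℂ) ^ ((j : ℕ) + 1) • mergeTerm f j
    + (-1 : ℂ) ^ (n + 1) • ContinuousMultilinearMap.uncurryRight (Ei := fun _ : Fin (n + 1) => A)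
        (M.right.flip.compContinuousMultilinearMap f)

/-- The formula
`(δⁿ f)(a₀, …, aₙ) = a₀ · f (a₁, …, aₙ) + ∑_{j < n} (-1)^(j+1) f (a₀, …, aⱼ aⱼ₊₁, …, aₙ)
  + (-1)^(n+1) f (a₀, …, aₙ₋₁) · aₙ`. -/
theorem coboundaryFun_apply (M : BanachBimodule A X) (n : ℕ)
    (f : ContinuousMultilinearMap ℂ (fun _ : Fin n => A) X) (a : Fin (n + 1) → A) :
    coboundaryFun M n f a =
      M.left (a 0) (f fun i => a i.succ)
        + ∑ j : Fin n, (-1 : ℂ) ^ ((j : ℕ) + 1) •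
            f (Fin.contractNth j.castSucc (· * ·) a)
        + (-1 : ℂ) ^ (n + 1) • M.right (a (Fin.last n)) (f fun i => a i.castSucc) := by
  simp only [coboundaryFun, _root_.add_apply, _root_.sum_apply,
    _root_.smul_apply]
  rfl

/-- The coboundary operator `δⁿ : Cⁿ(A, X) → Cⁿ⁺¹(A, X)` of the standard cohomological complex;
`Cⁿ(A, X)` is the space of bounded `n`-linear maps (for `n = 0` it is `X`). -/
noncomputable def coboundary (M : BanachBimodule A X) (n : ℕ) :
    ContinuousMultilinearMap ℂ (fun _ : Fin n => A) X →ₗ[ℂ]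
      ContinuousMultilinearMap ℂ (fun _ : Fin (n + 1) => A) X where
  toFun := coboundaryFun M n
  map_add' f g := by
    ext a
    simp only [coboundaryFun_apply, _root_.add_apply, map_add, smul_add,
      Finset.sum_add_distrib]
    abel
  map_smul' c f := by
    ext a
    simp only [coboundaryFun_apply, _root_.smul_apply, map_smul, smul_add,
      Finset.smul_sum, RingHom.id_apply]
    simp only [smul_comm c]

/-- The space of `n`-coboundaries: the range of `δⁿ⁻¹`, and `0` for `n = 0`. -/
noncomputable def coboundaries (M : BanachBimodule A X) :
    (n : ℕ) → Submodule ℂ (ContinuousMultilinearMap ℂ (fun _ : Fin n => A) X)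
  | 0 => ⊥
  | n + 1 => LinearMap.range (coboundary M n)

/-- The continuous Hochschild cohomology group `Hⁿ(A, X) = ker δⁿ / im δⁿ⁻¹`. -/
abbrev HochschildCohomology (M : BanachBimodule A X) (n : ℕ) : Type (max u v) :=
  LinearMap.ker (coboundary M n) ⧸
    (coboundaries M n).comap (LinearMap.ker (coboundary M n)).subtype

end Hochschild

/-! ## Continuous fields of Banach algebras -/

/-- A continuous field of Banach algebras over `Ω` with fibres `A t`, given by its algebra `Θ` of
continuous vector fields. -/
structure ContinuousField (Ω : Type u) [TopologicalSpace Ω] (A : Ω → Type v)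
    [∀ t, NonUnitalNormedRing (A t)] [∀ t, NormedSpace ℂ (A t)] where
  /-- the continuous vector fields -/
  Θ : NonUnitalSubalgebra ℂ (∀ t, A t)
  dense_eval : ∀ t : Ω, Dense {a : A t | ∃ x ∈ Θ, x t = a}
  continuous_norm : ∀ x ∈ Θ, Continuous fun t => ‖x t‖
  mem_of_locally_approx : ∀ x : ∀ t, A t,
    (∀ t : Ω, ∀ ε : ℝ, 0 < ε → ∃ x' ∈ Θ, ∀ᶠ s in 𝓝 t, ‖x s - x' s‖ ≤ ε) → x ∈ Θ

namespace ContinuousField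

variable {Ω : Type u} [TopologicalSpace Ω] {A : Ω → Type v}
  [∀ t, NonUnitalNormedRing (A t)] [∀ t, NormedSpace ℂ (A t)]

/-- A vector field `x` over `Y ⊆ Ω` is continuous on `Y`: near every point of `Y` (in the relative
topology of `Y`) it is uniformly approximated by elements of `Θ`. These fields are the continuous
vector fields of the induced field on `Y`. -/
def IsContinuousOver (𝒰 : ContinuousField Ω A) (Y : Set Ω) (x : ∀ t : Y, A t) : Prop :=
  ∀ t : Y, ∀ ε : ℝ, 0 < ε → ∃ x' ∈ 𝒰.Θ, ∀ᶠ s : Y in 𝓝 t, ‖x s - x' s‖ ≤ ε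

/-- The induced field on `Y` is trivial: there are a Banach algebra `B` and isometric isomorphisms
of Banach algebras `φ t : A t → B`, `t ∈ Y`, that carry the continuous vector fields over `Y`
exactly onto the continuous maps `Y → B`. -/
def IsTrivialOver (𝒰 : ContinuousField Ω A) (Y : Set Ω) : Prop :=
  ∃ (B : Type v) (_ : NonUnitalNormedRing B) (_ : NormedSpace ℂ B)
    (_ : IsScalarTower ℂ B B) (_ : SMulCommClass ℂ B B) (_ : CompleteSpace B)
    (φ : ∀ t : Y, A t ≃ₗᵢ[ℂ] B),
    (∀ (t : Y) (a b : A t), φ t (a * b) = φ t a * φ t b) ∧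
    ∀ x : ∀ t : Y, A t, 𝒰.IsContinuousOver Y x ↔ Continuous fun t : Y => φ t (x t)

/-- Every point of `Ω` has a neighbourhood over which the field is trivial. -/
def IsLocallyTrivial (𝒰 : ContinuousField Ω A) : Prop :=
  ∀ t : Ω, ∃ V ∈ 𝓝 t, 𝒰.IsTrivialOver V

theorem bounded_of_vanishing (𝒰 : ContinuousField Ω A) {x : ∀ t, A t} (hx : x ∈ 𝒰.Θ)
    (h0 : Tendsto (fun t => ‖x t‖) (cocompact Ω) (𝓝 0)) : Memℓp x ∞ := by
  obtain ⟨K, hK, hKs⟩ := mem_cocompact.1 (h0.eventually (gt_mem_nhds one_pos))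
  obtain ⟨C, hC⟩ := hK.bddAbove_image (𝒰.continuous_norm x hx).continuousOn
  refine memℓp_infty ⟨max C 1, ?_⟩
  rintro _ ⟨t, rfl⟩
  by_cases ht : t ∈ K
  · exact (hC ⟨t, ht, rfl⟩).trans (le_max_left _ _)
  · exact (le_of_lt (hKs ht)).trans (le_max_right _ _)

/-- The Banach algebra defined by the field: all `x ∈ Θ` such that `‖x t‖` vanishes at infinity on
`Ω`, with pointwise operations and the norm `‖x‖ = sup_t ‖x t‖`. It is carved out of the Banach
algebra of all bounded vector fields with the supremum norm; nothing is lost thereby, as the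
elements in question are bounded. -/
def sectionAlgebra (𝒰 : ContinuousField Ω A) : NonUnitalSubalgebra ℂ (lp A ∞) where
  carrier := {x | (⇑x : ∀ t, A t) ∈ 𝒰.Θ ∧ Tendsto (fun t => ‖x t‖) (cocompact Ω) (𝓝 0)}
  zero_mem' := ⟨𝒰.Θ.zero_mem, by simp [tendsto_const_nhds]⟩
  add_mem' := by
    rintro x y ⟨hx, hx0⟩ ⟨hy, hy0⟩
    refine ⟨𝒰.Θ.add_mem hx hy, ?_⟩
    exact squeeze_zero (fun _ => norm_nonneg _) (fun t => norm_add_le (x t) (y t))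
      (by simpa using hx0.add hy0)
  mul_mem' := by
    rintro x y ⟨hx, hx0⟩ ⟨hy, hy0⟩
    refine ⟨𝒰.Θ.mul_mem hx hy, ?_⟩
    exact squeeze_zero (fun _ => norm_nonneg _) (fun t => norm_mul_le (x t) (y t))
      (by simpa using hx0.mul hy0)
  smul_mem' := by
    rintro c x ⟨hx, hx0⟩
    refine ⟨𝒰.Θ.smul_mem' c hx, ?_⟩
    exact squeeze_zero (fun _ => norm_nonneg _) (fun t => norm_smul_le c (x t))
      (by simpa using hx0.const_mul ‖c‖)

theorem mem_sectionAlgebra (𝒰 : ContinuousField Ω A) (x : lp A ∞) :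
    x ∈ 𝒰.sectionAlgebra ↔
      (⇑x : ∀ t, A t) ∈ 𝒰.Θ ∧ Tendsto (fun t => ‖x t‖) (cocompact Ω) (𝓝 0) := Iff.rfl

/-- Every `x ∈ Θ` vanishing at infinity is (the underlying vector field of) an element of the
section algebra. -/
theorem exists_section (𝒰 : ContinuousField Ω A) {x : ∀ t, A t} (hx : x ∈ 𝒰.Θ)
    (h0 : Tendsto (fun t => ‖x t‖) (cocompact Ω) (𝓝 0)) :
    ∃ a : 𝒰.sectionAlgebra, ∀ t, (a : lp A ∞) t = x t :=
  ⟨⟨⟨x, 𝒰.bounded_of_vanishing hx h0⟩, hx, h0⟩, fun _ => rfl⟩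

theorem norm_section (𝒰 : ContinuousField Ω A) (a : 𝒰.sectionAlgebra) :
    ‖a‖ = ⨆ t, ‖(a : lp A ∞) t‖ :=
  lp.norm_eq_ciSup (a : lp A ∞)

noncomputable instance normedSpace_sectionAlgebra (𝒰 : ContinuousField Ω A) :
    NormedSpace ℂ 𝒰.sectionAlgebra where
  norm_smul_le c a := norm_smul_le c (a : lp A ∞)

/-- The section algebra is complete, hence a Banach algebra. -/
instance completeSpace_sectionAlgebra [∀ t, CompleteSpace (A t)] (𝒰 : ContinuousField Ω A) :
    CompleteSpace 𝒰.sectionAlgebra := by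
  have hclosed : IsClosed (𝒰.sectionAlgebra : Set (lp A ∞)) := by
    refine isClosed_of_closure_subset fun x hx => ?_
    have happ : ∀ ε : ℝ, 0 < ε → ∃ y ∈ 𝒰.sectionAlgebra, ∀ t, ‖x t - y t‖ < ε := by
      intro ε hε
      obtain ⟨y, hy, hxy⟩ := Metric.mem_closure_iff.1 hx ε hε
      refine ⟨y, hy, fun t => lt_of_le_of_lt ?_ (dist_eq_norm x y ▸ hxy)⟩
      exact lp.norm_apply_le_norm ENNReal.top_ne_zero (x - y) t
    refine ⟨𝒰.mem_of_locally_approx _ fun t ε hε => ?_, ?_⟩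
    · obtain ⟨y, hy, h⟩ := happ ε hε
      exact ⟨_, hy.1, Eventually.of_forall fun s => (h s).le⟩
    · refine Metric.tendsto_nhds.2 fun ε hε => ?_
      obtain ⟨y, hy, h⟩ := happ (ε / 2) (half_pos hε)
      filter_upwards [Metric.tendsto_nhds.1 hy.2 (ε / 2) (half_pos hε)] with t ht
      have h1 := norm_le_norm_add_norm_sub' (x t) (y t)
      have h2 := h t
      simp only [dist_zero_right, norm_norm] at ht ⊢
      linarith
  exact hclosed.completeSpace_coe

end ContinuousField

end ContFieldAlg

/-! All three conditions are compared with a fourth: every bounded derivation of the algebra into a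
Banach bimodule is inner (`DerivationsInner`).

For any Banach algebra this is the same as contractibility. A derivation twists the bimodule `X ×
A₊`, and a bimodule splitting of its projection onto `A₊` implements the derivation. Conversely, a
linear lift of `e` is corrected to a central one by an element implementing its commutator
derivation. The condition says that `H¹` vanishes, and absorbing one variable into the coefficients
then kills all higher groups.

Suppose that the section algebra has only inner derivations. Then it has a left unit, whose norm is
at least `1` in every non-zero fibre although it vanishes at infinity, so `Ω` is compact. Local
triviality allows values at nearby points to be subtracted. The derivation `a(s) - a(t)` is
implemented by a continuous function that vanishes on the diagonal and has norm at least `1` off it,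
so `Ω` is discrete, hence finite. Each fibre inherits the condition because evaluation has dense
range. Conversely, over a finite discrete base the section algebra is a finite sum of mutually
annihilating fibres, and implementing elements can be assembled block by block. -/

namespace ContFieldAlg

/-! ## Derivations -/

section Derivation

variable {A : Type u} [NonUnitalNormedRing A] [NormedSpace ℂ A]

/-- A bounded linear map `D : A → X` satisfying the Leibniz rule. -/
def BanachBimodule.IsDerivation {X : Type w} [NormedAddCommGroup X] [NormedSpace ℂ X]
    (M : BanachBimodule A X) (D : A →L[ℂ] X) : Prop :=
  ∀ a b, D (a * b) = M.left a (D b) + M.right b (D a)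

/-- `D` is the inner derivation `a ↦ a · z - z · a`. -/
def BanachBimodule.IsInnerBy {X : Type w} [NormedAddCommGroup X] [NormedSpace ℂ X]
    (M : BanachBimodule A X) (D : A →L[ℂ] X) (z : X) : Prop :=
  ∀ a, D a = M.left a z - M.right a z

variable (A) in
/-- Every derivation of `A` into a Banach bimodule living in the universe `w` is inner. -/
def DerivationsInner : Prop :=
  ∀ (X : Type w) [NormedAddCommGroup X] [NormedSpace ℂ X] [CompleteSpace X]
    (M : BanachBimodule A X) (D : A →L[ℂ] X), M.IsDerivation D → ∃ z, M.IsInnerBy D z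

/-! ### Invariant subspaces and independence of the universe of coefficients -/

section Restrict

variable {X : Type w} [NormedAddCommGroup X] [NormedSpace ℂ X]
  {X' : Type v} [NormedAddCommGroup X'] [NormedSpace ℂ X']

theorem exists_factor_through_isometry {E : Type*} [NormedAddCommGroup E] [NormedSpace ℂ E]
    (J : X' →ₗᵢ[ℂ] X) (T : E →L[ℂ] X) (h : ∀ a, ∃ y, J y = T a) :
    ∃ T' : E →L[ℂ] X', ∀ a, J (T' a) = T a := by
  choose g hg using h
  refine ⟨LinearMap.mkContinuous
    { toFun := g
      map_add' := fun a b => J.injective (by simp [hg])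
      map_smul' := fun c a => J.injective (by simp [hg]) } ‖T‖ fun a => ?_, hg⟩
  change ‖g a‖ ≤ _
  rw [← J.norm_map, hg]
  exact T.le_opNorm a

theorem exists_factor_through_isometry₂ {E : Type*} [NormedAddCommGroup E] [NormedSpace ℂ E]
    (J : X' →ₗᵢ[ℂ] X) (T : E →L[ℂ] X →L[ℂ] X) (h : ∀ a x, ∃ y, J y = T a (J x)) :
    ∃ T' : E →L[ℂ] X' →L[ℂ] X', ∀ a x, J (T' a x) = T a (J x) := by
  choose g hg using h
  refine ⟨LinearMap.mkContinuous₂ (LinearMap.mk₂ ℂ g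
    (fun a b x => J.injective (by simp [hg])) (fun c a x => J.injective (by simp [hg]))
    (fun a x y => J.injective (by simp [hg])) (fun c a x => J.injective (by simp [hg])))
    ‖T‖ fun a x => ?_, hg⟩
  change ‖g a x‖ ≤ _
  rw [← J.norm_map, hg, ← J.norm_map x]
  exact T.le_opNorm₂ a (J x)

/-- A subspace that is invariant under both actions is a Banach bimodule. -/
theorem BanachBimodule.exists_restrict (M : BanachBimodule A X) (J : X' →ₗᵢ[ℂ] X)
    (hl : ∀ a x, ∃ y, J y = M.left a (J x)) (hr : ∀ a x, ∃ y, J y = M.right a (J x)) :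
    ∃ M' : BanachBimodule A X', M'.IsMorphism M J.toContinuousLinearMap := by
  obtain ⟨l, hl⟩ := exists_factor_through_isometry₂ J M.left hl
  obtain ⟨r, hr⟩ := exists_factor_through_isometry₂ J M.right hr
  exact ⟨⟨l, r, fun a b x => J.injective (by simp [hl, M.left_mul]),
    fun a b x => J.injective (by simp [hr, M.right_mul]),
    fun a b x => J.injective (by simp [hl, hr, M.left_right])⟩, hl, hr⟩

/-- A derivation with values in an invariant subspace is implemented by an element of that
subspace. -/
theorem DerivationsInner.exists_mem_range [CompleteSpace X'] (h : DerivationsInner.{u, v} A)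
    (M : BanachBimodule A X) (J : X' →ₗᵢ[ℂ] X)
    (hl : ∀ a x, ∃ y, J y = M.left a (J x)) (hr : ∀ a x, ∃ y, J y = M.right a (J x))
    {D : A →L[ℂ] X} (hD : M.IsDerivation D) (hDJ : ∀ a, ∃ y, J y = D a) :
    ∃ z, M.IsInnerBy D (J z) := by
  obtain ⟨M', hM'l, hM'r⟩ := M.exists_restrict J hl hr
  obtain ⟨D', hD'⟩ := exists_factor_through_isometry J D hDJ
  simp only [LinearIsometry.coe_toContinuousLinearMap] at hM'l hM'r
  obtain ⟨z, hz⟩ := h X' M' D' fun a b => J.injective <| by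
    rw [hD', hD, map_add, hM'l, hM'r, hD', hD']
  exact ⟨z, fun a => by rw [← hD', hz a, map_sub, hM'l, hM'r]⟩

theorem DerivationsInner.exists_mem_submodule {X : Type v} [NormedAddCommGroup X]
    [NormedSpace ℂ X] [CompleteSpace X] (h : DerivationsInner.{u, v} A)
    (M : BanachBimodule A X) (N : Submodule ℂ X) (hN : IsClosed (N : Set X))
    (hl : ∀ a, ∀ x ∈ N, M.left a x ∈ N) (hr : ∀ a, ∀ x ∈ N, M.right a x ∈ N)
    {D : A →L[ℂ] X} (hD : M.IsDerivation D) (hDN : ∀ a, D a ∈ N) :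
    ∃ z ∈ N, M.IsInnerBy D z := by
  have : CompleteSpace N := hN.completeSpace_coe
  obtain ⟨z, hz⟩ := h.exists_mem_range M N.subtypeₗᵢ (fun a x => ⟨⟨_, hl a x x.2⟩, rfl⟩)
    (fun a x => ⟨⟨_, hr a x x.2⟩, rfl⟩) hD fun a => ⟨⟨_, hDN a⟩, rfl⟩
  exact ⟨z, z.2, hz⟩

/-- Every point of the closure is the limit of a sequence in `s`, so the closure is covered by an
image of the small type `ℕ → s`. -/
theorem small_closure {Y : Type w} [MetricSpace Y] (s : Set Y) [Small.{v} s] :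
    Small.{v} (closure s) := by
  rcases isEmpty_or_nonempty Y with hY | hY
  · infer_instance
  have : Small.{v} (ℕ → s) := small_map ((Equiv.refl ℕ).arrowCongr (equivShrink.{v} s))
  have : Small.{v} (Set.range fun f : ℕ → s => limUnder atTop fun n => (f n : Y)) := small_range _
  have hs : closure s ⊆ Set.range fun f : ℕ → s => limUnder atTop fun n => (f n : Y) := by
    intro x hx
    obtain ⟨f, hf, hfx⟩ := mem_closure_iff_seq_limit.1 hx
    exact ⟨fun n => ⟨f n, hf n⟩, hfx.limUnder_eq⟩
  exact small_subset hs

/-- A derivation takes its values in a closed sub-bimodule that is no larger than the algebra, so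
the universe of the coefficients does not matter. -/
theorem DerivationsInner.lift (h : DerivationsInner.{u, u} A) : DerivationsInner.{u, w} A := by
  intro X _ _ _ M D hD
  let S : Submodule ℂ X := Submodule.span ℂ
    (Set.range D ∪ Set.range fun p : A × A => M.left p.1 (D p.2))
  have hD1 : ∀ a, D a ∈ S := fun a => Submodule.subset_span (Or.inl ⟨a, rfl⟩)
  have hD2 : ∀ a b, M.left a (D b) ∈ S := fun a b => Submodule.subset_span (Or.inr ⟨(a, b), rfl⟩)
  -- The Leibniz rule trades right actions on values of `D` for left ones, so the generators `D b`
  -- and `a · D b` already span a subspace stable on both sides.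
  have hr' : ∀ a b, M.right a (D b) = D (b * a) - M.left b (D a) := fun a b => by
    rw [hD]; abel
  have hlS : ∀ a, S ≤ S.comap (M.left a : X →ₗ[ℂ] X) := fun a => Submodule.span_le.2 <| by
    rintro _ (⟨b, rfl⟩ | ⟨⟨b, c⟩, rfl⟩)
    · exact hD2 a b
    · change M.left a (M.left b (D c)) ∈ S
      rw [← M.left_mul]
      exact hD2 _ _
  have hrS : ∀ a, S ≤ S.comap (M.right a : X →ₗ[ℂ] X) := fun a => Submodule.span_le.2 <| by
    rintro _ (⟨b, rfl⟩ | ⟨⟨b, c⟩, rfl⟩)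
    · change M.right a (D b) ∈ S
      rw [hr']
      exact S.sub_mem (hD1 _) (hD2 _ _)
    · change M.right a (M.left b (D c)) ∈ S
      rw [← M.left_right, hr', map_sub, ← M.left_mul]
      exact S.sub_mem (hD2 _ _) (hD2 _ _)
  let N := S.topologicalClosure
  have hNl : ∀ a, ∀ x ∈ N, M.left a x ∈ N := fun a x hx =>
    map_mem_closure (M.left a).continuous hx fun y hy => hlS a hy
  have hNr : ∀ a, ∀ x ∈ N, M.right a x ∈ N := fun a x hx =>
    map_mem_closure (M.right a).continuous hx fun y hy => hrS a hy
  -- The generators are indexed by `A` and `A × A`; hence the span and its closure are small and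
  -- have a copy in the universe of `A`.
  have : Small.{u} S := Submodule.small_span _
  have : Small.{u} (S : Set X) := ‹Small.{u} S›
  have : Small.{u} N := small_closure (S : Set X)
  have : CompleteSpace N := S.isClosed_topologicalClosure.completeSpace_coe
  let e : Shrink.{u} N ≃ₗᵢ[ℂ] N :=
    { (Shrink.linearEquiv ℂ N) with norm_map' := fun x => rfl }
  have : CompleteSpace (Shrink.{u} N) := e.toIsometryEquiv.completeSpace
  obtain ⟨z, hz⟩ := h.exists_mem_range M (N.subtypeₗᵢ.comp e.toLinearIsometry)
    (fun a x => ⟨e.symm ⟨_, hNl a _ (e x).2⟩, by simp⟩)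
    (fun a x => ⟨e.symm ⟨_, hNr a _ (e x).2⟩, by simp⟩) hD
    fun a => ⟨e.symm ⟨_, S.le_topologicalClosure (hD1 a)⟩, by simp⟩
  exact ⟨_, hz⟩

end Restrict

/-! ## Change of the algebra -/

/-- Restriction of the actions along a bounded homomorphism. -/
@[simps]
noncomputable def BanachBimodule.pullback {B : Type v} [NonUnitalNormedRing B] [NormedSpace ℂ B]
    {X : Type w} [NormedAddCommGroup X] [NormedSpace ℂ X] (M : BanachBimodule B X)
    (π : A →L[ℂ] B) (hπ : ∀ a b, π (a * b) = π a * π b) : BanachBimodule A X where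
  left := M.left.comp π
  right := M.right.comp π
  left_mul a b x := by simp [hπ, M.left_mul]
  right_mul a b x := by simp [hπ, M.right_mul]
  left_right a b x := by simp [M.left_right]

/-- An element implementing the pulled-back derivation implements the original one on the range of
`π`, and then everywhere by continuity. -/
theorem DerivationsInner.of_denseRange {B : Type v} [NonUnitalNormedRing B] [NormedSpace ℂ B]
    (h : DerivationsInner.{u, w} A) (π : A →L[ℂ] B) (hπ : ∀ a b, π (a * b) = π a * π b)
    (hd : DenseRange π) : DerivationsInner.{v, w} B := by
  intro X _ _ _ M D hD
  obtain ⟨z, hz⟩ := h X (M.pullback π hπ) (D.comp π) fun a b => by simp [hπ, hD _ _]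
  refine ⟨z, fun b => ?_⟩
  have hc : Continuous fun b => M.left b z - M.right b z :=
    (M.left.flip z - M.right.flip z).continuous
  exact congrFun (hd.equalizer D.continuous hc (funext hz)) b

/-- An algebra that is the sum of finitely many mutually annihilating algebras inherits the
property that all derivations are inner. -/
theorem DerivationsInner.of_finite_sum {ι : Type*} [Fintype ι] {B : ι → Type v}
    [∀ i, NonUnitalNormedRing (B i)] [∀ i, NormedSpace ℂ (B i)]
    (h : ∀ i, DerivationsInner.{v, w} (B i)) (j : ∀ i, B i →L[ℂ] A)
    (hj : ∀ i a b, j i (a * b) = j i a * j i b)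
    (hjk : ∀ i k, i ≠ k → ∀ a b, j i a * j k b = 0)
    (hsum : ∀ a, ∃ b : ∀ i, B i, a = ∑ i, j i (b i)) : DerivationsInner.{u, w} A := by
  classical
  intro X _ _ _ M D hD
  -- Induction on the set of blocks on which a single element implements `D`.
  suffices H : ∀ s : Finset ι, ∃ z, ∀ i ∈ s, ∀ b, D (j i b) =
      M.left (j i b) z - M.right (j i b) z by
    obtain ⟨z, hz⟩ := H Finset.univ
    refine ⟨z, fun a => ?_⟩
    obtain ⟨b, rfl⟩ := hsum a
    simp only [map_sum, _root_.sum_apply, ← Finset.sum_sub_distrib]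
    exact Finset.sum_congr rfl fun i hi => hz i hi _
  intro s
  induction s using Finset.induction_on with
  | empty => exact ⟨0, by simp⟩
  | insert k s hk ih =>
    obtain ⟨z, hz⟩ := ih
    -- Subtracting the inner derivation found so far leaves one that vanishes on the blocks in `s`.
    let D' : A →L[ℂ] X := D - (M.left.flip z - M.right.flip z)
    have hD'a : ∀ a, D' a = D a - (M.left a z - M.right a z) := fun a => rfl
    have hD' : M.IsDerivation D' := fun a b => by
      simp only [hD'a, hD a b, map_sub, M.left_mul, M.right_mul, M.left_right]
      abel
    have hD'0 : ∀ i ∈ s, ∀ b, D' (j i b) = 0 := fun i hi b => by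
      rw [hD'a, hz i hi, sub_self]
    -- Elements annihilated on both sides by the blocks in `s`: a correction taken from `N` for the
    -- block `k` does not disturb the earlier blocks.
    let N : Submodule ℂ X := ⨅ i ∈ s, ⨅ b : B i,
      LinearMap.ker (M.left (j i b) : X →ₗ[ℂ] X) ⊓ LinearMap.ker (M.right (j i b) : X →ₗ[ℂ] X)
    have hN : ∀ x, x ∈ N ↔ ∀ i ∈ s, ∀ b, M.left (j i b) x = 0 ∧ M.right (j i b) x = 0 := by
      simp [N, Submodule.mem_iInf]
    have hNc : IsClosed (N : Set X) := by
      have : (N : Set X) =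
          {x | ∀ i ∈ s, ∀ b, M.left (j i b) x = 0 ∧ M.right (j i b) x = 0} :=
        Set.ext hN
      rw [this]
      simp only [Set.ofPred_forall, Set.ofPred_and]
      exact isClosed_iInter fun i => isClosed_iInter fun _ => isClosed_iInter fun b =>
        (isClosed_singleton.preimage (M.left (j i b)).continuous).inter
          (isClosed_singleton.preimage (M.right (j i b)).continuous)
    have hne : ∀ i ∈ s, i ≠ k := fun i hi hik => hk (hik ▸ hi)
    obtain ⟨y, hyN, hy⟩ := (h k).exists_mem_submodule (M.pullback (j k) (hj k)) N hNc
      (D := D'.comp (j k))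
      (fun a x hx => (hN _).2 fun i hi b => by
        simp [← M.left_mul, ← M.left_right, hjk i k (hne i hi), ((hN x).1 hx i hi b).2])
      (fun a x hx => (hN _).2 fun i hi b => by
        simp [← M.right_mul, M.left_right, hjk k i (hne i hi).symm, ((hN x).1 hx i hi b).1])
      (fun a b => by simp [hj, hD' _ _])
      (fun a => (hN _).2 fun i hi b => by
        -- Applied to the zero products of the blocks `i` and `k`, in both orders, the Leibniz rule
        -- shows that `D'` maps the block `k` into `N`.
        have h1 := hD' (j i b) (j k a)
        have h2 := hD' (j k a) (j i b)
        rw [hjk _ _ (hne i hi), hD'0 i hi] at h1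
        rw [hjk _ _ (hne i hi).symm, hD'0 i hi] at h2
        simp only [map_zero, add_zero, zero_add] at h1 h2
        exact ⟨h1.symm, h2.symm⟩)
    refine ⟨z + y, fun i hi b => ?_⟩
    rcases Finset.mem_insert.1 hi with rfl | hi
    · have := hy b
      simp only [ContinuousLinearMap.comp_apply, hD'a, BanachBimodule.pullback_left,
        BanachBimodule.pullback_right] at this
      rw [map_add, map_add, add_sub_add_comm, ← this]
      abel
    · rw [map_add, map_add, ((hN y).1 hyN i hi b).1, ((hN y).1 hyN i hi b).2, hz i hi b]
      abel

end Derivation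

/-! ## Contractibility and derivations -/

section Contractible

variable {A : Type u} [NonUnitalNormedRing A] [NormedSpace ℂ A]

/-- The extension of a bounded linear map `T` on `A` to `A₊` with `e ↦ x`. -/
noncomputable def extendPlus {X : Type w} [NormedAddCommGroup X] [NormedSpace ℂ X]
    (T : A →L[ℂ] X) (x : X) : Aplus A →L[ℂ] X :=
  LinearMap.mkContinuous
    { toFun := fun p => T (WithLp.ofLp p).snd + (WithLp.ofLp p).fst • x
      map_add' := fun p q => by simp [add_smul]; abel
      map_smul' := fun c p => by simp [smul_smul] } (‖T‖ + ‖x‖) fun p => by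
    change ‖T (WithLp.ofLp p).snd + (WithLp.ofLp p).fst • x‖ ≤ _
    rw [WithLp.unitization_norm_def]
    have h1 := T.le_opNorm (WithLp.ofLp p).snd
    have h2 := norm_add_le (T (WithLp.ofLp p).snd) ((WithLp.ofLp p).fst • x)
    rw [norm_smul] at h2
    nlinarith [mul_nonneg (norm_nonneg T) (norm_nonneg (WithLp.ofLp p).fst),
      mul_nonneg (norm_nonneg x) (norm_nonneg (WithLp.ofLp p).snd)]

variable [IsScalarTower ℂ A A] [SMulCommClass ℂ A A]

/-- The decomposition `p = a + λ e` in `A₊`. -/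
theorem exists_eq_inclPlus_add (p : Aplus A) :
    ∃ (a : A) (c : ℂ), p = inclPlus A a + c • (1 : Aplus A) := by
  refine ⟨(WithLp.ofLp p).snd, (WithLp.ofLp p).fst, ?_⟩
  apply (WithLp.equiv 1 (Unitization ℂ A)).injective
  apply Unitization.ext
  · change _ = (0 : ℂ) + (WithLp.ofLp p).fst * 1
    simp
  · change _ = (WithLp.ofLp p).snd + (WithLp.ofLp p).fst • (0 : A)
    simp

@[simp]
theorem extendPlus_inclPlus {X : Type w} [NormedAddCommGroup X] [NormedSpace ℂ X]
    (T : A →L[ℂ] X) (x : X) (a : A) : extendPlus T x (inclPlus A a) = T a := by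
  change T a + (0 : ℂ) • x = _
  simp

@[simp]
theorem extendPlus_one {X : Type w} [NormedAddCommGroup X] [NormedSpace ℂ X]
    (T : A →L[ℂ] X) (x : X) : extendPlus T x (1 : Aplus A) = x := by
  change T 0 + (1 : ℂ) • x = _
  simp

/-- For a derivation `D : A → X`, the extension of `A₊` by `X` with right action
`(x, p) · a = (x · a + p · D a, p a)`. -/
noncomputable def extensionBimodule {X : Type w} [NormedAddCommGroup X] [NormedSpace ℂ X]
    (M : BanachBimodule A X) (D : A →L[ℂ] X) (hD : M.IsDerivation D) :
    BanachBimodule A (X × Aplus A) where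
  left := (ContinuousLinearMap.compL ℂ (X × Aplus A) X (X × Aplus A)
        (ContinuousLinearMap.inl ℂ X (Aplus A))).comp
      (M.left.bilinearComp (ContinuousLinearMap.id ℂ A) (ContinuousLinearMap.fst ℂ X (Aplus A)))
    + (ContinuousLinearMap.compL ℂ (X × Aplus A) (Aplus A) (X × Aplus A)
        (ContinuousLinearMap.inr ℂ X (Aplus A))).comp
      ((plusBimodule A).left.bilinearComp (ContinuousLinearMap.id ℂ A)
        (ContinuousLinearMap.snd ℂ X (Aplus A)))
  right := (ContinuousLinearMap.compL ℂ (X × Aplus A) X (X × Aplus A)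
        (ContinuousLinearMap.inl ℂ X (Aplus A))).comp
      (M.right.bilinearComp (ContinuousLinearMap.id ℂ A) (ContinuousLinearMap.fst ℂ X (Aplus A))
        + (extendPlus M.left (ContinuousLinearMap.id ℂ X)).flip.bilinearComp D
          (ContinuousLinearMap.snd ℂ X (Aplus A)))
    + (ContinuousLinearMap.compL ℂ (X × Aplus A) (Aplus A) (X × Aplus A)
        (ContinuousLinearMap.inr ℂ X (Aplus A))).comp
      ((plusBimodule A).right.bilinearComp (ContinuousLinearMap.id ℂ A)
        (ContinuousLinearMap.snd ℂ X (Aplus A)))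
  left_mul a b x := by
    simp [M.left_mul, (plusBimodule A).left_mul]
  right_mul a b x := by
    -- Associativity of the twisted right action is the Leibniz rule for `D`, multiplied on the left
    -- by `p`.
    obtain ⟨x, p⟩ := x
    obtain ⟨c, l, rfl⟩ := exists_eq_inclPlus_add p
    simp [M.right_mul, plusBimodule_right, add_mul, mul_assoc, hD a b, M.left_right,
      ← inclPlus_mul, M.left_mul]
    abel
  left_right a b x := by
    obtain ⟨x, p⟩ := x
    obtain ⟨c, l, rfl⟩ := exists_eq_inclPlus_add p
    simp [plusBimodule_right, plusBimodule_left, add_mul, mul_add, M.left_right,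
      ← inclPlus_mul, M.left_mul, mul_assoc]

theorem extensionBimodule_left {X : Type w} [NormedAddCommGroup X] [NormedSpace ℂ X]
    (M : BanachBimodule A X) (D : A →L[ℂ] X) (hD : M.IsDerivation D) (a : A) (y : X × Aplus A) :
    (extensionBimodule M D hD).left a y = (M.left a y.1, inclPlus A a * y.2) := by
  simp [extensionBimodule, plusBimodule_left]

theorem extensionBimodule_right {X : Type w} [NormedAddCommGroup X] [NormedSpace ℂ X]
    (M : BanachBimodule A X) (D : A →L[ℂ] X) (hD : M.IsDerivation D) (a : A) (y : X × Aplus A) :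
    (extensionBimodule M D hD).right a y =
      (M.right a y.1 + extendPlus M.left (ContinuousLinearMap.id ℂ X) y.2 (D a),
        y.2 * inclPlus A a) := by
  simp [extensionBimodule, plusBimodule_right]

/-- A bimodule splitting of `X × A₊ → A₊` sends `e` to some `(x, e)`. Since `a · e = e · a`, the
first coordinates of `a · (x, e)` and `(x, e) · a` agree, which reads `a · x = x · a + D a`. -/
theorem IsContractible.derivationsInner [CompleteSpace A] (h : IsContractible A) :
    DerivationsInner.{u, u} A := by
  intro X _ _ _ M D hD
  obtain ⟨ψ, ⟨hl, hr⟩, hψ⟩ := h (X × Aplus A) (extensionBimodule M D hD)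
    (ContinuousLinearMap.snd ℂ X (Aplus A))
    ⟨fun a y => by simp [extensionBimodule_left, plusBimodule_left],
      fun a y => by simp [extensionBimodule_right, plusBimodule_right]⟩
    ⟨ContinuousLinearMap.inr ℂ X (Aplus A), by ext; simp⟩
  have hψ1 : (ψ 1).2 = 1 := congrArg (fun T => T (1 : Aplus A)) hψ
  refine ⟨(ψ 1).1, fun a => ?_⟩
  have h1 := congrArg Prod.fst (hl a 1)
  have h2 := congrArg Prod.fst (hr a 1)
  simp only [extensionBimodule_left, extensionBimodule_right, plusBimodule_left,
    plusBimodule_right, one_mul, mul_one, hψ1, extendPlus_one,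
    ContinuousLinearMap.id_apply] at h1 h2
  rw [← h1, h2]
  abel

/-- The commutator derivation of `σ e` takes values in `ker φ`, because `φ (σ e) = e` commutes with
`A`. If `z ∈ ker φ` implements it, then `y = σ e - z` still lies over `e` and commutes with the
actions, so `a + λ e ↦ a · y + λ y` is a bimodule splitting. -/
theorem DerivationsInner.isContractible (h : DerivationsInner.{u, u} A) : IsContractible A := by
  intro Y _ _ _ N φ hφ ⟨σ, hσ⟩
  have hσ1 : φ (σ 1) = 1 := congrArg (fun T => T (1 : Aplus A)) hσ
  let D : A →L[ℂ] Y := N.left.flip (σ 1) - N.right.flip (σ 1)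
  have hDa : ∀ a, D a = N.left a (σ 1) - N.right a (σ 1) := fun a => rfl
  obtain ⟨z, hz, hDz⟩ := h.exists_mem_submodule N (LinearMap.ker (φ : Y →ₗ[ℂ] Aplus A))
    φ.isClosed_ker (D := D)
    (fun a x hx => by
      rw [LinearMap.mem_ker, ContinuousLinearMap.coe_coe] at hx ⊢
      rw [hφ.1, hx, map_zero])
    (fun a x hx => by
      rw [LinearMap.mem_ker, ContinuousLinearMap.coe_coe] at hx ⊢
      rw [hφ.2, hx, map_zero])
    (fun a b => by
      simp only [hDa, map_sub, N.left_mul, N.right_mul, N.left_right]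
      abel)
    (fun a => by
      rw [LinearMap.mem_ker, ContinuousLinearMap.coe_coe, hDa, map_sub, hφ.1, hφ.2, hσ1,
        plusBimodule_left, plusBimodule_right, one_mul, mul_one, sub_self])
  rw [LinearMap.mem_ker, ContinuousLinearMap.coe_coe] at hz
  obtain ⟨y, hφy, hy⟩ : ∃ y, φ y = 1 ∧ ∀ a, N.left a y = N.right a y := by
    refine ⟨σ 1 - z, by rw [map_sub, hσ1, hz, sub_zero], fun a => ?_⟩
    have := hDz a
    rw [hDa] at this
    rw [map_sub, map_sub, sub_eq_sub_iff_sub_eq_sub, this]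
  refine ⟨extendPlus (N.left.flip y) y, ⟨fun a p => ?_, fun a p => ?_⟩, ?_⟩
  · obtain ⟨b, c, rfl⟩ := exists_eq_inclPlus_add p
    rw [plusBimodule_left, mul_add, ← inclPlus_mul, mul_smul_comm, mul_one]
    simp only [map_add, map_smul, extendPlus_inclPlus, extendPlus_one,
      ContinuousLinearMap.flip_apply, N.left_mul]
  · obtain ⟨b, c, rfl⟩ := exists_eq_inclPlus_add p
    rw [plusBimodule_right, add_mul, ← inclPlus_mul, smul_mul_assoc, one_mul]
    simp only [map_add, map_smul, extendPlus_inclPlus, extendPlus_one,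
      ContinuousLinearMap.flip_apply, N.left_mul]
    rw [← N.left_right, hy a]
  · ext p
    obtain ⟨b, c, rfl⟩ := exists_eq_inclPlus_add p
    simp only [ContinuousLinearMap.comp_apply, map_add, map_smul, extendPlus_inclPlus,
      extendPlus_one, ContinuousLinearMap.flip_apply, ContinuousLinearMap.id_apply, hφ.1, hφy,
      plusBimodule_left, mul_one]

end Contractible

/-! ## Derivations and Hochschild cohomology -/

section Cohomology

variable {A : Type u} [NonUnitalNormedRing A] [NormedSpace ℂ A]
  [IsScalarTower ℂ A A] [SMulCommClass ℂ A A]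

theorem subsingleton_hochschildCohomology_succ_iff {X : Type w} [NormedAddCommGroup X]
    [NormedSpace ℂ X] (M : BanachBimodule A X) (n : ℕ) :
    Subsingleton (HochschildCohomology M (n + 1)) ↔
      ∀ f, coboundary M (n + 1) f = 0 → ∃ g, coboundary M n g = f := by
  rw [Submodule.Quotient.subsingleton_iff, Submodule.eq_top_iff']
  simp only [Subtype.forall, LinearMap.mem_ker, Submodule.mem_comap, Submodule.subtype_apply]
  rfl

theorem subsingleton_hochschildCohomology_one_iff {X : Type w} [NormedAddCommGroup X]
    [NormedSpace ℂ X] (M : BanachBimodule A X) :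
    Subsingleton (HochschildCohomology M 1) ↔
      ∀ D : A →L[ℂ] X, M.IsDerivation D → ∃ z, M.IsInnerBy D z := by
  rw [subsingleton_hochschildCohomology_succ_iff]
  have hδ0 : ∀ (g : ContinuousMultilinearMap ℂ (fun _ : Fin 0 => A) X) (a : Fin 1 → A),
      coboundary M 0 g a = M.left (a 0) (g 0) - M.right (a 0) (g 0) := by
    intro g a
    change coboundaryFun M 0 g a = _
    rw [coboundaryFun_apply]
    have hg : ∀ m : Fin 0 → A, g m = g 0 := fun m => congrArg g (Subsingleton.elim _ _)
    simp [hg, sub_eq_add_neg]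
  have hδ1 : ∀ (g : ContinuousMultilinearMap ℂ (fun _ : Fin 1 => A) X) (a : Fin 2 → A),
      coboundary M 1 g a =
        M.left (a 0) (g fun _ => a 1) - g (fun _ => a 0 * a 1) + M.right (a 1) (g fun _ => a 0) := by
    intro g a
    change coboundaryFun M 1 g a = _
    rw [coboundaryFun_apply]
    have h0 : Fin.contractNth (Fin.castSucc 0) (· * ·) a = fun _ : Fin 1 => a 0 * a 1 := by
      ext i
      simp [Fin.contractNth, Subsingleton.elim i 0]
    have h1 : (fun i : Fin 1 => a i.succ) = fun _ => a 1 := by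
      ext i
      simp [Subsingleton.elim i 0]
    have h2 : (fun i : Fin 1 => a i.castSucc) = fun _ => a 0 := by
      ext i
      simp [Subsingleton.elim i 0]
    rw [h1, h2, Fin.sum_univ_one, h0]
    simp [sub_eq_add_neg]
  change (∀ f : ContinuousMultilinearMap ℂ (fun _ : Fin 1 => A) X, coboundary M 1 f = 0 →
    ∃ g, coboundary M 0 g = f) ↔ _
  constructor
  · intro h D hD
    obtain ⟨g, hg⟩ := h (ContinuousMultilinearMap.ofSubsingleton ℂ A X 0 D) (by
      ext a
      simp [hδ1, hD _ _])
    refine ⟨g 0, fun a => ?_⟩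
    have := congrArg (fun f => f fun _ => a) hg
    simpa [hδ0] using this.symm
  · intro h f hf
    obtain ⟨D, rfl⟩ := (ContinuousMultilinearMap.ofSubsingleton ℂ A X (0 : Fin 1)).surjective f
    obtain ⟨z, hz⟩ := h D fun a b => by
      have := congrArg (fun f => f ![a, b]) hf
      simp [hδ1] at this
      rw [← sub_eq_zero, ← neg_eq_zero, ← this]
      abel
    refine ⟨ContinuousMultilinearMap.constOfIsEmpty ℂ (fun _ : Fin 0 => A) z, ?_⟩
    ext a
    simp [hδ0, hz _]

/-- The bimodule of bounded linear maps `T : A → X` with actions `(a · T) b = a · T b` and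
`(T · a) b = T (a b) - T a · b`. -/
noncomputable def homBimodule {X : Type w} [NormedAddCommGroup X] [NormedSpace ℂ X]
    (M : BanachBimodule A X) : BanachBimodule A (A →L[ℂ] X) where
  left := (ContinuousLinearMap.compL ℂ A X X).comp M.left
  right := (ContinuousLinearMap.compL ℂ A A X).flip.comp (ContinuousLinearMap.mul ℂ A)
    - (ContinuousLinearMap.compL ℂ (A →L[ℂ] X) X (A →L[ℂ] X) M.right.flip).comp
      (ContinuousLinearMap.apply ℂ X)
  left_mul a b T := by ext; simp [M.left_mul]
  right_mul a b T := by ext; simp [M.right_mul, mul_assoc]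
  left_right a b T := by ext; simp [M.left_right]

theorem homBimodule_left_apply {X : Type w} [NormedAddCommGroup X] [NormedSpace ℂ X]
    (M : BanachBimodule A X) (a b : A) (T : A →L[ℂ] X) :
    (homBimodule M).left a T b = M.left a (T b) := rfl

theorem homBimodule_right_apply {X : Type w} [NormedAddCommGroup X] [NormedSpace ℂ X]
    (M : BanachBimodule A X) (a b : A) (T : A →L[ℂ] X) :
    (homBimodule M).right a T b = T (a * b) - M.right b (T a) := rfl

/-- Currying the last variable commutes with the coboundaries, without a sign. The two terms of the
right action on `homBimodule M` supply exactly the last merging term and the right-action term of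
the next coboundary. -/
theorem uncurryRight_coboundary {X : Type w} [NormedAddCommGroup X] [NormedSpace ℂ X]
    (M : BanachBimodule A X) (n : ℕ)
    (g : ContinuousMultilinearMap ℂ (fun _ : Fin n => A) (A →L[ℂ] X)) :
    ContinuousMultilinearMap.uncurryRight (Ei := fun _ : Fin (n + 2) => A)
        (coboundary (homBimodule M) n g) =
      coboundary M (n + 1)
        (ContinuousMultilinearMap.uncurryRight (Ei := fun _ : Fin (n + 1) => A) g) := by
  ext a
  rw [ContinuousMultilinearMap.uncurryRight_apply]
  change coboundaryFun (homBimodule M) n g (Fin.init a) _ = coboundaryFun M (n + 1) _ a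
  rw [coboundaryFun_apply, coboundaryFun_apply, Fin.sum_univ_castSucc]
  simp only [_root_.add_apply, _root_.sum_apply, _root_.smul_apply,
    homBimodule_left_apply, homBimodule_right_apply, ContinuousMultilinearMap.uncurryRight_apply]
  -- The first `n` mergings leave the last variable alone; the remaining one multiplies the last two
  -- variables.
  have h1 : ∀ j : Fin n, Fin.init (Fin.contractNth j.castSucc.castSucc (· * ·) a) =
      Fin.contractNth j.castSucc (· * ·) (Fin.init a) := fun j => by
    ext i
    simp only [Fin.init, Fin.contractNth]
    rfl
  have h2 : ∀ j : Fin n, Fin.contractNth j.castSucc.castSucc (· * ·) a (Fin.last n) =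
      a (Fin.last (n + 1)) := fun j => by
    rw [Fin.contractNth_apply_of_gt _ _ _ _ (by simp)]
    simp
  have h3 : Fin.init (Fin.contractNth (Fin.last n).castSucc (· * ·) a) =
      fun i => Fin.init a i.castSucc := by
    ext i
    rw [Fin.init, Fin.contractNth_apply_of_lt _ _ _ _ (by simp)]
    rfl
  have h4 : Fin.contractNth (Fin.last n).castSucc (· * ·) a (Fin.last n) =
      Fin.init a (Fin.last n) * a (Fin.last (n + 1)) := by
    rw [Fin.contractNth_apply_of_eq _ _ _ _ (by simp)]
    rfl
  simp only [h1, h2, h3, h4]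
  have h5 : Fin.init (fun i : Fin (n + 1) => a i.succ) = fun i => Fin.init a i.succ := rfl
  have h6 : Fin.init (fun i : Fin (n + 1) => a i.castSucc) =
    fun i => Fin.init a i.castSucc := rfl
  -- The extra factor `-1` matches the minus sign in `T (a b) - T a · b`.
  rw [h5, h6, pow_succ _ (n + 1)]
  simp only [Fin.val_castSucc, Fin.val_last, Fin.succ_last, smul_sub, mul_neg, mul_one, neg_smul]
  exact (fun p q r s => by abel : ∀ p q r s : X, p + q + (r - s) = p + (q + r) + -s) _ _ _ _

/-- Dimension shifting reduces the vanishing of higher cohomology to that of derivations. -/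
theorem DerivationsInner.subsingleton_hochschildCohomology (h : DerivationsInner.{u, u} A)
    (n : ℕ) : ∀ (X : Type u) [NormedAddCommGroup X] [NormedSpace ℂ X] [CompleteSpace X]
      (M : BanachBimodule A X), Subsingleton (HochschildCohomology M (n + 1)) := by
  induction n with
  | zero =>
    intro X _ _ _ M
    exact (subsingleton_hochschildCohomology_one_iff M).2 (h X M)
  | succ n ih =>
    intro X _ _ _ M
    refine (subsingleton_hochschildCohomology_succ_iff M _).2 fun f hf => ?_
    have := (subsingleton_hochschildCohomology_succ_iff (homBimodule M) n).1 (ih _ _)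
    -- The curried cocycle is a cocycle of one degree less, with coefficients in `homBimodule M`.
    obtain ⟨g, hg⟩ := this f.curryRight <| by
      rw [← ContinuousMultilinearMap.curry_uncurryRight (Ei := fun _ : Fin (n + 3) => A)
        (coboundary (homBimodule M) (n + 1) f.curryRight), uncurryRight_coboundary,
        ContinuousMultilinearMap.uncurry_curryRight, hf]
      rfl
    refine ⟨ContinuousMultilinearMap.uncurryRight (Ei := fun _ : Fin (n + 1) => A) g, ?_⟩
    rw [← uncurryRight_coboundary, hg, ContinuousMultilinearMap.uncurry_curryRight]

end Cohomology

/-! ### Units, cut-offs and compactness of the base -/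

/-- With zero left action and multiplication on the right, the identity of `A` is a derivation.
Being implemented by `z` means `a = -z a`. -/
theorem DerivationsInner.exists_unit {A : Type u} [NonUnitalNormedRing A] [NormedSpace ℂ A]
    [IsScalarTower ℂ A A] [SMulCommClass ℂ A A] [CompleteSpace A]
    (h : DerivationsInner.{u, u} A) : ∃ e : A, ∀ a, e * a = a := by
  obtain ⟨z, hz⟩ := h A
    { left := 0
      right := (ContinuousLinearMap.mul ℂ A).flip
      left_mul := by simp
      right_mul := by simp [mul_assoc]
      left_right := by simp } (ContinuousLinearMap.id ℂ A) fun a b => by simp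
  exact ⟨-z, fun a => by simpa using (hz a).symm⟩

namespace ContinuousField

variable {Ω : Type u} [TopologicalSpace Ω] {A : Ω → Type v}
  [∀ t, NonUnitalNormedRing (A t)] [∀ t, NormedSpace ℂ (A t)]

theorem exists_mem_ne_zero (𝒰 : ContinuousField Ω A) (t : Ω) [Nontrivial (A t)] :
    ∃ x ∈ 𝒰.Θ, x t ≠ 0 := by
  obtain ⟨a, ha⟩ := exists_ne (0 : A t)
  obtain ⟨_, h0, x, hx, rfl⟩ := (𝒰.dense_eval t).inter_open_nonempty {0}ᶜ
    isOpen_compl_singleton ⟨a, ha⟩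
  exact ⟨x, hx, h0⟩

/-- `Θ` is a module over the continuous scalar functions. -/
theorem smul_mem (𝒰 : ContinuousField Ω A) {f : Ω → ℂ} (hf : Continuous f) {x : ∀ t, A t}
    (hx : x ∈ 𝒰.Θ) : (fun t => f t • x t) ∈ 𝒰.Θ := by
  -- Near `t` the scalar function is frozen at its value `f t`.
  refine 𝒰.mem_of_locally_approx _ fun t ε hε => ⟨f t • x, 𝒰.Θ.smul_mem' _ hx, ?_⟩
  have h : Continuous fun s => ‖f s - f t‖ * ‖x s‖ :=
    (hf.sub continuous_const).norm.mul (𝒰.continuous_norm x hx)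
  have h0 : Tendsto (fun s => ‖f s - f t‖ * ‖x s‖) (𝓝 t) (𝓝 0) := by
    simpa using h.tendsto t
  filter_upwards [h0.eventually (gt_mem_nhds hε)] with s hs
  rw [Pi.smul_apply, ← sub_smul]
  exact (norm_smul_le _ _).trans hs.le

/-- Multiplication by a compactly supported Urysohn function, equal to `1` at `s` and `0` on `C`,
makes the field vanish at infinity. -/
theorem exists_section_eq_of_notMem [T2Space Ω] [LocallyCompactSpace Ω] (𝒰 : ContinuousField Ω A)
    {x : ∀ t, A t} (hx : x ∈ 𝒰.Θ) {C : Set Ω} (hC : IsClosed C) {s : Ω} (hs : s ∉ C) :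
    ∃ a : 𝒰.sectionAlgebra, (a : lp A ∞) s = x s ∧ ∀ t ∈ C, (a : lp A ∞) t = 0 := by
  obtain ⟨f, hf1, hf0, hfc, -⟩ := exists_continuous_one_zero_of_isCompact
    (isCompact_singleton (x := s)) hC (Set.disjoint_singleton_left.2 hs)
  obtain ⟨a, ha⟩ := 𝒰.exists_section
    (𝒰.smul_mem (Complex.continuous_ofReal.comp f.continuous) hx) <| by
      refine tendsto_const_nhds.congr' ?_
      filter_upwards [hfc.isCompact.compl_mem_cocompact] with t ht
      have : f t = 0 := image_eq_zero_of_notMem_tsupport ht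
      simp [this]
  refine ⟨a, ?_, fun t ht => ?_⟩
  · simp [ha, hf1 (Set.mem_singleton s)]
  · simp [ha, hf0 ht]

/-- Evaluation of a section at a point. -/
noncomputable def eval (𝒰 : ContinuousField Ω A) (t : Ω) : 𝒰.sectionAlgebra →L[ℂ] A t :=
  LinearMap.mkContinuous
    { toFun := fun a => (a : lp A ∞) t
      map_add' := fun _ _ => rfl
      map_smul' := fun _ _ => rfl } 1 fun a => by
    rw [one_mul]
    exact lp.norm_apply_le_norm ENNReal.top_ne_zero (a : lp A ∞) t

theorem eval_apply (𝒰 : ContinuousField Ω A) (t : Ω) (a : 𝒰.sectionAlgebra) :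
    𝒰.eval t a = (a : lp A ∞) t := rfl

theorem norm_eval_le (𝒰 : ContinuousField Ω A) (t : Ω) (a : 𝒰.sectionAlgebra) :
    ‖𝒰.eval t a‖ ≤ ‖a‖ :=
  lp.norm_apply_le_norm ENNReal.top_ne_zero (a : lp A ∞) t

theorem eval_mul (𝒰 : ContinuousField Ω A) (t : Ω) (a b : 𝒰.sectionAlgebra) :
    𝒰.eval t (a * b) = 𝒰.eval t a * 𝒰.eval t b := rfl

theorem eval_ext (𝒰 : ContinuousField Ω A) {a b : 𝒰.sectionAlgebra}
    (h : ∀ t, 𝒰.eval t a = 𝒰.eval t b) : a = b :=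
  Subtype.ext (lp.ext (funext h))

theorem denseRange_eval [T2Space Ω] [LocallyCompactSpace Ω] (𝒰 : ContinuousField Ω A) (t : Ω) :
    DenseRange (𝒰.eval t) := by
  refine (𝒰.dense_eval t).mono ?_
  rintro _ ⟨x, hx, rfl⟩
  obtain ⟨a, ha, -⟩ := 𝒰.exists_section_eq_of_notMem hx isClosed_empty (Set.notMem_empty t)
  exact ⟨a, ha⟩

/-- A left unit fixes a non-zero vector in each fibre, so its norm is at least `1` at every point;
as it vanishes at infinity, a compact set must be all of `Ω`. -/
theorem compactSpace_of_unit [T2Space Ω] [LocallyCompactSpace Ω] [∀ t, Nontrivial (A t)]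
    (𝒰 : ContinuousField Ω A) {e : 𝒰.sectionAlgebra} (he : ∀ a, e * a = a) :
    CompactSpace Ω := by
  have h1 : ∀ t, 1 ≤ ‖(e : lp A ∞) t‖ := fun t => by
    obtain ⟨x, hx, hxt⟩ := 𝒰.exists_mem_ne_zero t
    obtain ⟨a, ha, -⟩ := 𝒰.exists_section_eq_of_notMem hx isClosed_empty (Set.notMem_empty t)
    have h := norm_mul_le (𝒰.eval t e) (𝒰.eval t a)
    rw [← eval_mul, he, eval_apply, eval_apply, ha] at h
    exact (le_mul_iff_one_le_left (norm_pos_iff.2 hxt)).1 h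
  have h2 := e.2.2.eventually (gt_mem_nhds one_pos)
  obtain ⟨K, hK, hKs⟩ := mem_cocompact.1 h2
  have hKu : K = Set.univ := Set.eq_univ_of_forall fun t => by
    by_contra ht
    exact absurd (hKs ht) (not_lt.2 (h1 t))
  exact ⟨hKu ▸ hK⟩

/-! ### Local triviality and discreteness of the base -/

section Trivialization

variable {B : Type v} [NonUnitalNormedRing B] [NormedSpace ℂ B]

/-- A trivialization over `V` and a continuous map from a compact space `Y` to `V` induce a
homomorphism from the section algebra to the continuous functions on `Y`. -/
theorem exists_toContinuousMap (𝒰 : ContinuousField Ω A) {V : Set Ω} {Y : Type w}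
    [TopologicalSpace Y] [CompactSpace Y] (g : C(Y, V)) (φ : ∀ t : V, A t ≃ₗᵢ[ℂ] B)
    (hφ : ∀ (t : V) (a b : A t), φ t (a * b) = φ t a * φ t b)
    (hc : ∀ x : ∀ t : V, A t, 𝒰.IsContinuousOver V x → Continuous fun t : V => φ t (x t)) :
    ∃ τ : 𝒰.sectionAlgebra →L[ℂ] C(Y, B), (∀ a b, τ (a * b) = τ a * τ b) ∧
      ∀ a s, τ a s = φ (g s) (𝒰.eval (g s) a) := by
  have hcont : ∀ a : 𝒰.sectionAlgebra,
      Continuous fun s : Y => φ (g s) (𝒰.eval (g s) a) := fun a =>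
    (hc (fun t => 𝒰.eval t a) fun t ε hε => ⟨_, a.2.1, Eventually.of_forall fun s => by
      simp [eval_apply, hε.le]⟩).comp g.continuous
  refine ⟨LinearMap.mkContinuous
    { toFun := fun a => ⟨fun s => φ (g s) (𝒰.eval (g s) a), hcont a⟩
      map_add' := fun a b => by ext s; simp
      map_smul' := fun c a => by ext s; simp } 1 fun a => ?_, fun a b => ?_, fun a s => rfl⟩
  · rw [one_mul]
    refine (ContinuousMap.norm_le _ (norm_nonneg a)).2 fun s => ?_
    exact ((φ (g s)).norm_map _).trans_le (𝒰.norm_eval_le (g s) a)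
  · ext s
    exact hφ _ _ _

end Trivialization

/-- If all derivations of the section algebra are inner, then the base is discrete: over a compact
neighbourhood `K` on which the field is trivial with fibre `B`, the derivation
`a ↦ (a(s) - a(t))` into the functions `K × K → B` vanishing on the diagonal is implemented by a
continuous function whose norm is at least `1` off the diagonal. -/
theorem discreteTopology_of_derivationsInner [T2Space Ω] [LocallyCompactSpace Ω]
    [∀ t, Nontrivial (A t)] (𝒰 : ContinuousField Ω A) (hloc : 𝒰.IsLocallyTrivial)
    (h : DerivationsInner.{max u v, max u v} 𝒰.sectionAlgebra) : DiscreteTopology Ω := by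
  refine discreteTopology_iff_isOpen_singleton.2 fun t₀ => isOpen_singleton_iff_nhds_eq_pure _ |>.2
    (le_antisymm ?_ (pure_le_nhds t₀))
  obtain ⟨V, hV, B, _, _, _, _, _, φ, hφ, hφc⟩ := hloc t₀
  obtain ⟨K, hK, hKV, hKc⟩ := local_compact_nhds hV
  have : CompactSpace K := isCompact_iff_compactSpace.1 hKc
  let i : C(K, V) := ⟨Set.inclusion hKV, continuous_inclusion hKV⟩
  obtain ⟨p, hpm, hp⟩ := 𝒰.exists_toContinuousMap (i.comp ContinuousMap.fst : C(K × K, V)) φ hφ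
    fun x => (hφc x).1
  obtain ⟨q, hqm, hq⟩ := 𝒰.exists_toContinuousMap (i.comp ContinuousMap.snd : C(K × K, V)) φ hφ
    fun x => (hφc x).1
  -- Sections act on the left through their value at the first point and on the right through their
  -- value at the second, so `p - q` is a derivation.
  let M : BanachBimodule 𝒰.sectionAlgebra C(K × K, B) :=
    { left := (ContinuousLinearMap.mul ℂ C(K × K, B)).comp p
      right := (ContinuousLinearMap.mul ℂ C(K × K, B)).flip.comp q
      left_mul := by simp [hpm, mul_assoc]
      right_mul := by simp [hqm, mul_assoc]
      left_right := by simp [mul_assoc] }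
  have hMl : ∀ a F, M.left a F = p a * F := fun a F => rfl
  have hMr : ∀ a F, M.right a F = F * q a := fun a F => rfl
  let N : Submodule ℂ C(K × K, B) :=
    { carrier := {F | ∀ s, F (s, s) = 0}
      zero_mem' := fun s => rfl
      add_mem' := fun hF hG s => by simp [hF s, hG s]
      smul_mem' := fun c F hF s => by simp [hF s] }
  have hN : IsClosed (N : Set C(K × K, B)) := by
    change IsClosed {F : C(K × K, B) | ∀ s, F (s, s) = 0}
    rw [Set.ofPred_forall]
    exact isClosed_iInter fun s => isClosed_eq (continuous_eval_const (s, s)) continuous_const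
  obtain ⟨z, hz, hpq⟩ := h.exists_mem_submodule M N hN
    (fun a F hF s => by rw [hMl, ContinuousMap.mul_apply, hF s, mul_zero])
    (fun a F hF s => by rw [hMr, ContinuousMap.mul_apply, hF s, zero_mul]) (D := p - q)
    (fun a b => by
      simp only [_root_.sub_apply, hMl, hMr, hpm, hqm, mul_sub, sub_mul]
      abel)
    (fun a s => by
      rw [_root_.sub_apply, ContinuousMap.sub_apply, hp, hq]
      exact sub_self _)
  -- For a section with `a(t) = 0` and `a(s) ≠ 0`, the implementing identity at `(s, t)` becomes
  -- `a(s) = a(s) z(s, t)` in `B`.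
  have hoff : ∀ s t : K, s ≠ t → 1 ≤ ‖z (s, t)‖ := fun s t hst => by
    obtain ⟨x, hx, hxs⟩ := 𝒰.exists_mem_ne_zero (s : Ω)
    obtain ⟨a, has, hat⟩ := 𝒰.exists_section_eq_of_notMem hx
      (isClosed_singleton (x := (t : Ω))) (s := s) (fun hs => hst (Subtype.ext hs))
    have hpa : p a (s, t) = φ (i s) (x s) := (hp a (s, t)).trans (congrArg (φ (i s)) has)
    have hqa : q a (s, t) = 0 := (hq a (s, t)).trans <|
      (congrArg (φ (i t)) (hat t rfl)).trans (map_zero _)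
    have hpa0 : 0 < ‖p a (s, t)‖ := by
      rw [hpa, LinearIsometryEquiv.norm_map]
      exact norm_pos_iff.2 hxs
    have h1 := congrArg (fun F : C(K × K, B) => F (s, t)) (hpq a)
    simp only [_root_.sub_apply, ContinuousMap.sub_apply, hMl, hMr, ContinuousMap.mul_apply, hqa,
      mul_zero, sub_zero] at h1
    have h2 := norm_mul_le (p a (s, t)) (z (s, t))
    rw [← h1] at h2
    exact (le_mul_iff_one_le_right hpa0).1 h2
  let k₀ : K := ⟨t₀, mem_of_mem_nhds hK⟩
  -- The function `‖z (·, k₀)‖` is `0` at `k₀` and at least `1` elsewhere, so `k₀` is isolated in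
  -- `K`, and hence `t₀` in `Ω`, as `K` is a neighbourhood.
  have hzc : Continuous fun s : K => ‖z (s, k₀)‖ := by fun_prop
  have hev : ∀ᶠ s : K in 𝓝 k₀, s = k₀ := by
    have h0 := hzc.tendsto k₀
    rw [hz k₀, norm_zero] at h0
    filter_upwards [h0.eventually (gt_mem_nhds one_pos)] with s hs
    by_contra hne
    exact absurd hs (not_lt.2 (hoff s k₀ hne))
  rw [← map_nhds_subtype_coe_eq_nhds (mem_of_mem_nhds hK) hK]
  intro U hU
  rw [mem_map]
  filter_upwards [hev] with s hs
  exact hs ▸ hU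

/-! ### Finite discrete base and the main theorem -/

/-- The section supported at a single point of a finite discrete space. -/
theorem exists_single [Finite Ω] [DiscreteTopology Ω] (𝒰 : ContinuousField Ω A) (t : Ω) :
    ∃ j : A t →L[ℂ] 𝒰.sectionAlgebra, (∀ a, 𝒰.eval t (j a) = a) ∧
      ∀ a, ∀ s ≠ t, 𝒰.eval s (j a) = 0 := by
  classical
  have hmem : ∀ a : A t, lp.single ∞ t a ∈ 𝒰.sectionAlgebra := fun a => by
    refine ⟨𝒰.mem_of_locally_approx _ fun s ε hε => ?_, by simp⟩
    -- In a discrete space local approximation concerns one point only, where density of the values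
    -- of `Θ` suffices.
    simp only [nhds_discrete, eventually_pure]
    by_cases hst : s = t
    · subst hst
      obtain ⟨_, ⟨x, hx, rfl⟩, hxa⟩ := Metric.mem_closure_iff.1 (𝒰.dense_eval s a) ε hε
      exact ⟨x, hx, by simpa [← dist_eq_norm] using hxa.le⟩
    · exact ⟨0, 𝒰.Θ.zero_mem, by simp [hst, hε.le]⟩
  refine ⟨LinearMap.mkContinuous
    { toFun := fun a => ⟨lp.single ∞ t a, hmem a⟩
      map_add' := fun a b => Subtype.ext (lp.single_add ∞ t a b)
      map_smul' := fun c a => Subtype.ext (lp.single_smul ∞ t c a) } 1 fun a => ?_,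
    fun a => lp.single_apply_self ∞ t a, fun a s hst => lp.single_apply_ne ∞ t a hst⟩
  rw [one_mul]
  exact (lp.norm_single ENNReal.zero_lt_top t a).le

theorem derivationsInner_sectionAlgebra [Finite Ω] [DiscreteTopology Ω] (𝒰 : ContinuousField Ω A)
    (h : ∀ t, DerivationsInner.{v, w} (A t)) : DerivationsInner.{max u v, w} 𝒰.sectionAlgebra := by
  have := Fintype.ofFinite Ω
  choose j hj hj0 using 𝒰.exists_single
  refine DerivationsInner.of_finite_sum h j (fun t a b => 𝒰.eval_ext fun s => ?_)
    (fun t s hts a b => 𝒰.eval_ext fun r => ?_)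
    fun a => ⟨fun t => 𝒰.eval t a, 𝒰.eval_ext fun s => ?_⟩
  · rw [eval_mul]
    rcases eq_or_ne s t with rfl | hst
    · rw [hj, hj, hj]
    · rw [hj0 _ _ _ hst, hj0 _ _ _ hst, zero_mul]
  · rw [eval_mul, map_zero]
    rcases eq_or_ne r t with rfl | hrt
    · rw [hj0 s b r hts, mul_zero]
    · rw [hj0 t a r hrt, zero_mul]
  · rw [map_sum, Finset.sum_eq_single s (fun t _ hts => hj0 _ _ _ hts.symm) (by simp), hj]

end ContinuousField

end ContFieldAlg

theorem theorem5p2 {Ω : Type u} [TopologicalSpace Ω] [T2Space Ω] [LocallyCompactSpace Ω]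
    {A : Ω → Type v} [∀ t, NonUnitalNormedRing (A t)] [∀ t, NormedSpace ℂ (A t)]
    [∀ t, IsScalarTower ℂ (A t) (A t)] [∀ t, SMulCommClass ℂ (A t) (A t)]
    [∀ t, CompleteSpace (A t)] [∀ t, Nontrivial (A t)]
    (𝒰 : ContFieldAlg.ContinuousField Ω A) (hloc : 𝒰.IsLocallyTrivial) :
    List.TFAE [
      ContFieldAlg.IsContractible 𝒰.sectionAlgebra,
      Finite Ω ∧ DiscreteTopology Ω ∧ ∀ x : Ω, ContFieldAlg.IsContractible (A x),
      ∀ (X : Type (max u v)) [NormedAddCommGroup X] [NormedSpace ℂ X] [CompleteSpace X]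
        (M : ContFieldAlg.BanachBimodule 𝒰.sectionAlgebra X) (n : ℕ), 1 ≤ n →
          Subsingleton (ContFieldAlg.HochschildCohomology M n)] := by
  tfae_have 1 → 3 := fun h X _ _ _ M n hn => by
    obtain ⟨n, rfl⟩ := Nat.exists_eq_add_of_le' hn
    exact h.derivationsInner.subsingleton_hochschildCohomology n X M
  tfae_have 3 → 2 := fun h => by
    have h1 : ContFieldAlg.DerivationsInner.{max u v, max u v} 𝒰.sectionAlgebra :=
      fun X _ _ _ M =>
        (ContFieldAlg.subsingleton_hochschildCohomology_one_iff M).1 (h X M 1 le_rfl)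
    obtain ⟨e, he⟩ := h1.exists_unit
    have := 𝒰.compactSpace_of_unit he
    have := 𝒰.discreteTopology_of_derivationsInner hloc h1
    -- Contractibility of a fibre tests bimodules in the fibre's own universe, hence the use of
    -- `lift`.
    exact ⟨finite_of_compact_of_discrete, this, fun t =>
      (h1.lift.of_denseRange (𝒰.eval t) (𝒰.eval_mul t) (𝒰.denseRange_eval t)).isContractible⟩
  tfae_have 2 → 1 := fun ⟨_, _, h⟩ =>
    (𝒰.derivationsInner_sectionAlgebra fun t => (h t).derivationsInner.lift).isContractible
  tfae_finish
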